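/- Let $I=[0,1]$, let $\varepsilon>0$, and let $f\colon I\to I$ be continuous. For a compact metric space $(X,d)$ and a continuous map $g\colon X\to X$, call $g$ densely $\varepsilon$-chaotic if the set of pairs $(x,y)\in X\times X$ with $$\liminf_{n\to\infty} d(g^n(x),g^n(y))=0\quad\text{and}\quad \limsup_{n\to\infty} d(g^n(x),g^n(y))>\varepsilon$$ is dense in $X\times X$. Let $\mathcal K(I)$ be the space of all non-empty compact subsets of $I$ with the Hausdorff metric, and let $\overline f\colon\mathcal K(I)\to\mathcal K(I)$, $\overline f(K)=f(K)$, be the map induced by $f$. If $f$ is densely $\varepsilon$-chaotic, then $\overline f$ is densely $\varepsilon$-chaotic (with the same $\varepsilon$). -/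

import Mathlib

open Filter TopologicalSpace

namespace DenseChaos

variable {X : Type*} [MetricSpace X] [CompactSpace X]

/-- The set `C₁(f)` of pairs `(x, y)` with `liminf d(fⁿ x, fⁿ y) = 0`
(the distances are bounded, since `X` is compact). -/
def C₁ (f : C(X, X)) : Set (X × X) :=
  {p | liminf (fun n : ℕ => dist (f^[n] p.1) (f^[n] p.2)) atTop = 0}

/-- The set `C₂(f, ε)` of pairs `(x, y)` with `limsup d(fⁿ x, fⁿ y) > ε`. -/
def C₂ (f : C(X, X)) (ε : ℝ) : Set (X × X) :=
  {p | ε < limsup (fun n : ℕ => dist (f^[n] p.1) (f^[n] p.2)) atTop}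

/-- The set `C(f, ε) = C₁(f) ∩ C₂(f, ε)` of `ε`-Li-Yorke pairs of `f`. -/
def liYorkePairs (f : C(X, X)) (ε : ℝ) : Set (X × X) :=
  C₁ f ∩ C₂ f ε

/-- `f` is densely `ε`-chaotic: its `ε`-Li-Yorke pairs are dense in `X × X`. -/
def DenselyChaotic (f : C(X, X)) (ε : ℝ) : Prop :=
  Dense (liYorkePairs f ε)


/-- The map `K ↦ f(K)` induced by `f` on the space `NonemptyCompacts X` of non-empty compact
subsets of `X`, which carries the Hausdorff metric. -/
def induced (f : C(X, X)) : C(NonemptyCompacts X, NonemptyCompacts X) where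
  toFun K := K.map f f.continuous
  continuous_toFun := by fun_prop

end DenseChaos

/-!
Under dense `ε`-chaos every non-empty open set has arbitrarily late images containing a ball of
radius `ε / 2`. Among the open subsets of a given open set, one that keeps covering as few as
possible of finitely many such balls contains an open `J` each of whose non-empty open subsets
returns to cover `f^[T] '' J`. This recurrence passes to finite products, so by Baire's theorem
some tuple in `∏ i, J i` accumulates at every point of the closure of the product of the hulls
`H i`, the increasing unions of the images `f^[T + k * D] '' J i`.

The hulls are order-connected, and proximal pairs show that their closures meet pairwise, hence
have a common point `z`. The tuple `(z, …, z)` being an accumulation point gives liminf `0` for the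
Hausdorff distance between two sets of entries of the tuple. For the limsup, fix an index `i₀`. If
`H j` has a point strictly between two points of `H i₀`, recurrence forces `H i₀ ⊆ H j`; otherwise
`H j` has a point on either the left or the right of `H i₀` near `z`. Since `H i₀` contains two
points at distance `> ε`, one of them, `q`, is at distance `> ε` from some point of every `H j`, and
the tuple accumulates there too. Finally, finite sets are dense in the hyperspace.
-/

namespace DenseChaos

section LiYorkePairs

theorem isBoundedUnder_le_dist {X : Type*} [PseudoMetricSpace X] [CompactSpace X] (u v : ℕ → X) :
    IsBoundedUnder (· ≤ ·) atTop fun n => dist (u n) (v n) :=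
  isBoundedUnder_of ⟨Metric.diam (Set.univ : Set X), fun _ =>
    Metric.dist_le_diam_of_mem isCompact_univ.isBounded (Set.mem_univ _) (Set.mem_univ _)⟩

theorem isBoundedUnder_ge_dist {X : Type*} [PseudoMetricSpace X] (u v : ℕ → X) :
    IsBoundedUnder (· ≥ ·) atTop fun n => dist (u n) (v n) :=
  isBoundedUnder_of ⟨0, fun _ => dist_nonneg⟩

variable {X : Type*} [MetricSpace X] [CompactSpace X] {f : C(X, X)} {ε : ℝ} {p : X × X}

theorem mem_C₁_iff :
    p ∈ C₁ f ↔ MapClusterPt 0 atTop fun n : ℕ => dist (f^[n] p.1) (f^[n] p.2) := by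
  have hle := isBoundedUnder_le_dist (fun n => f^[n] p.1) fun n => f^[n] p.2
  have hge := isBoundedUnder_ge_dist (fun n => f^[n] p.1) fun n => f^[n] p.2
  refine ⟨fun h => ?_, fun h => le_antisymm (h.liminf_le hge) ?_⟩
  · have hcluster := MapClusterPt.liminf hle.isCoboundedUnder_ge hge
    rwa [show liminf (fun n : ℕ => dist (f^[n] p.1) (f^[n] p.2)) atTop = 0 from h] at hcluster
  · exact le_liminf_of_le hle.isCoboundedUnder_ge (Eventually.of_forall fun _ => dist_nonneg)

theorem mem_C₂_iff :
    p ∈ C₂ f ε ↔ ∃ δ > ε, MapClusterPt δ atTop fun n : ℕ => dist (f^[n] p.1) (f^[n] p.2) := by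
  have hle := isBoundedUnder_le_dist (fun n => f^[n] p.1) fun n => f^[n] p.2
  have hge := isBoundedUnder_ge_dist (fun n => f^[n] p.1) fun n => f^[n] p.2
  exact ⟨fun h => ⟨_, h, MapClusterPt.limsup hge.isCoboundedUnder_le hle⟩,
    fun ⟨_, hδ, h⟩ => lt_of_lt_of_le hδ (h.le_limsup hle)⟩

theorem DenselyChaotic.exists_frequently_dist (hf : DenselyChaotic f ε) {U V : Set X}
    (hU : IsOpen U) (hUne : U.Nonempty) (hV : IsOpen V) (hVne : V.Nonempty) :
    ∃ x ∈ U, ∃ y ∈ V, (∀ η > 0, ∃ᶠ n in atTop, dist (f^[n] x) (f^[n] y) < η) ∧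
      ∃ᶠ n in atTop, ε < dist (f^[n] x) (f^[n] y) := by
  obtain ⟨⟨x, y⟩, ⟨hx, hy⟩, hprox, hsep⟩ :=
    hf.inter_open_nonempty _ (hU.prod hV) (hUne.prod hVne)
  obtain ⟨δ, hδ, hcluster⟩ := mem_C₂_iff.1 hsep
  exact ⟨x, hx, y, hy, fun η hη => (mem_C₁_iff.1 hprox).frequently (eventually_lt_nhds hη),
    hcluster.frequently (eventually_gt_nhds hδ)⟩

end LiYorkePairs

theorem image_iterate_add_subset {X : Type*} {f : X → X} {A B : Set X} {a b : ℕ}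
    (h : f^[a] '' A ⊆ f^[b] '' B) (s : ℕ) : f^[a + s] '' A ⊆ f^[b + s] '' B := by
  rw [add_comm a, add_comm b, Function.iterate_add, Function.iterate_add, Set.image_comp,
    Set.image_comp]
  exact Set.image_mono h

section OrbitHull

variable {X : Type*} {f : X → X} {J : Set X} {T D : ℕ}

/-- The union of the images of `J` at the times `T`, `T + D`, `T + 2 * D`, … It is used when
`f^[T] '' J ⊆ f^[T + D] '' J`, so that these images increase. -/
def orbitHull (f : X → X) (T D : ℕ) (J : Set X) : Set X :=
  ⋃ k : ℕ, f^[T + k * D] '' J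

theorem image_iterate_subset_orbitHull (f : X → X) (T D k : ℕ) (J : Set X) :
    f^[T + k * D] '' J ⊆ orbitHull f T D J :=
  Set.subset_iUnion (fun k : ℕ => f^[T + k * D] '' J) k

theorem image_subset_orbitHull (f : X → X) (T D : ℕ) (J : Set X) :
    f^[T] '' J ⊆ orbitHull f T D J := by
  simpa using image_iterate_subset_orbitHull f T D 0 J

theorem monotone_image_iterate (hD : f^[T] '' J ⊆ f^[T + D] '' J) :
    Monotone fun k : ℕ => f^[T + k * D] '' J := by
  refine monotone_nat_of_le_succ fun k => ?_
  have hk := image_iterate_add_subset hD (k * D)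
  rwa [show T + D + k * D = T + (k + 1) * D by ring] at hk

theorem exists_forall_mem_image_of_mem_orbitHull {ι : Type*} [Finite ι] {X : ι → Type*}
    {f : ∀ i, X i → X i} {J : ∀ i, Set (X i)} (hD : ∀ i, (f i)^[T] '' J i ⊆ (f i)^[T + D] '' J i)
    {P : ∀ i, X i} (hP : ∀ i, P i ∈ orbitHull (f i) T D (J i)) :
    ∃ k, ∀ i, P i ∈ (f i)^[T + k * D] '' J i := by
  choose k hk using fun i => Set.mem_iUnion.1 (hP i)
  obtain ⟨K, hK⟩ := (Set.finite_range k).bddAbove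
  exact ⟨K, fun i => monotone_image_iterate (hD i) (hK ⟨i, rfl⟩) (hk i)⟩

theorem pi_orbitHull_subset {ι : Type*} [Finite ι] {X : ι → Type*}
    {f : ∀ i, X i → X i} {J : ∀ i, Set (X i)}
    (hD : ∀ i, (f i)^[T] '' J i ⊆ (f i)^[T + D] '' J i) :
    (Set.univ.pi fun i => orbitHull (f i) T D (J i)) ⊆
      orbitHull (Pi.map f) T D (Set.univ.pi J) := by
  intro P hP
  obtain ⟨k, hk⟩ := exists_forall_mem_image_of_mem_orbitHull hD fun i => hP i trivial
  refine image_iterate_subset_orbitHull _ T D k _ ?_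
  rw [Pi.map_iterate, Set.piMap_image_univ_pi]
  exact fun i _ => hk i

theorem isPreconnected_orbitHull [TopologicalSpace X] (hf : Continuous f) (hJ : IsPreconnected J)
    (hD : f^[T] '' J ⊆ f^[T + D] '' J) : IsPreconnected (orbitHull f T D J) :=
  IsPreconnected.sUnion_directed
    (directedOn_range.2 (monotone_image_iterate hD).directed_le)
    (Set.forall_mem_range.2 fun _ => hJ.image _ (hf.iterate _).continuousOn)

end OrbitHull

section Recurrence

variable {X : Type*} [TopologicalSpace X] {f : X → X} {J J' W : Set X} {T D : ℕ}

/-- Every non-empty open subset of `J` has, at some time after `T`, an image that covers the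
image of `J` at time `T`. Unlike topological transitivity, this passes to finite products. -/
def IsRecurrentAt (f : X → X) (T : ℕ) (J : Set X) : Prop :=
  ∀ W ⊆ J, IsOpen W → W.Nonempty → ∃ n > 0, f^[T] '' J ⊆ f^[T + n] '' W

namespace IsRecurrentAt

theorem mono_set (h : IsRecurrentAt f T J) (hJ : J' ⊆ J) : IsRecurrentAt f T J' := by
  intro W hW hWo hWne
  obtain ⟨n, hn, hsub⟩ := h W (hW.trans hJ) hWo hWne
  exact ⟨n, hn, (Set.image_mono hJ).trans hsub⟩

theorem mono_time (h : IsRecurrentAt f T J) {T' : ℕ} (hT : T ≤ T') : IsRecurrentAt f T' J := by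
  intro W hW hWo hWne
  obtain ⟨n, hn, hsub⟩ := h W hW hWo hWne
  refine ⟨n, hn, ?_⟩
  have hshift := image_iterate_add_subset hsub (T' - T)
  rwa [show T + (T' - T) = T' by omega, show T + n + (T' - T) = T' + n by omega] at hshift

theorem exists_forall_mul (h : IsRecurrentAt f T J) (hW : W ⊆ J) (hWo : IsOpen W)
    (hWne : W.Nonempty) : ∃ n > 0, ∀ k > 0, f^[T] '' J ⊆ f^[T + n * k] '' W := by
  obtain ⟨n, hn, hsub⟩ := h W hW hWo hWne
  refine ⟨n, hn, fun k hk => Nat.le_induction (by simpa using hsub) (fun k _ ih => ?_) k hk⟩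
  calc f^[T] '' J ⊆ f^[T + n] '' W := hsub
    _ ⊆ f^[T + n] '' J := Set.image_mono hW
    _ ⊆ f^[T + n * k + n] '' W := image_iterate_add_subset ih n
    _ = f^[T + n * (k + 1)] '' W := by rw [mul_add_one, add_assoc]

theorem exists_common_period {ι : Type*} [Finite ι] {X : ι → Type*} [∀ i, TopologicalSpace (X i)]
    {f : ∀ i, X i → X i} {J W : ∀ i, Set (X i)} (h : ∀ i, IsRecurrentAt (f i) T (J i))
    (hW : ∀ i, W i ⊆ J i) (hWo : ∀ i, IsOpen (W i)) (hWne : ∀ i, (W i).Nonempty) :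
    ∃ n > 0, ∀ i, (f i)^[T] '' J i ⊆ (f i)^[T + n] '' W i := by
  cases nonempty_fintype ι
  choose n hn hsub using fun i => (h i).exists_forall_mul (hW i) (hWo i) (hWne i)
  have hpos : 0 < ∏ i, n i := Finset.prod_pos fun i _ => hn i
  refine ⟨∏ i, n i, hpos, fun i => ?_⟩
  obtain ⟨k, hk⟩ := Finset.dvd_prod_of_mem n (Finset.mem_univ i)
  rw [hk] at hpos ⊢
  exact hsub i k (pos_of_mul_pos_right hpos (Nat.zero_le _))

theorem pi {ι : Type*} [Finite ι] {X : ι → Type*} [∀ i, TopologicalSpace (X i)]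
    {f : ∀ i, X i → X i} {J : ∀ i, Set (X i)} (h : ∀ i, IsRecurrentAt (f i) T (J i))
    (hJ : ∀ i, IsOpen (J i)) : IsRecurrentAt (Pi.map f) T (Set.univ.pi J) := by
  cases nonempty_fintype ι
  rintro W hW hWo ⟨a, ha⟩
  obtain ⟨u, hu, huW⟩ := isOpen_pi_iff'.1 hWo a ha
  obtain ⟨n, hn, hsub⟩ := exists_common_period h (W := fun i => u i ∩ J i)
    (fun i => Set.inter_subset_right) (fun i => (hu i).1.inter (hJ i))
    fun i => ⟨a i, (hu i).2, hW ha i trivial⟩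
  refine ⟨n, hn, ?_⟩
  calc (Pi.map f)^[T] '' Set.univ.pi J
      ⊆ (Pi.map f)^[T + n] '' Set.univ.pi fun i => u i ∩ J i := by
        rw [Pi.map_iterate, Pi.map_iterate, Set.piMap_image_univ_pi, Set.piMap_image_univ_pi]
        exact Set.pi_mono fun i _ => hsub i
    _ ⊆ (Pi.map f)^[T + n] '' W :=
        Set.image_mono ((Set.pi_mono fun i _ => Set.inter_subset_left).trans huW)

theorem frequently_mem_image (h : IsRecurrentAt f T J) {P : X} (hP : P ∈ orbitHull f T D J)
    (hW : W ⊆ J) (hWo : IsOpen W) (hWne : W.Nonempty) : ∃ᶠ n in atTop, P ∈ f^[n] '' W := by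
  obtain ⟨k, hk⟩ := Set.mem_iUnion.1 hP
  obtain ⟨n, hn, hsub⟩ := h.exists_forall_mul hW hWo hWne
  refine frequently_atTop.2 fun N => ⟨T + n * (N + 1) + k * D, ?_,
    image_iterate_add_subset (hsub (N + 1) N.succ_pos) (k * D) hk⟩
  have hN : N + 1 ≤ n * (N + 1) := Nat.le_mul_of_pos_left _ hn
  omega

theorem exists_forall_mapClusterPt [BaireSpace X] [SecondCountableTopology X]
    (h : IsRecurrentAt f T J) (hf : Continuous f) (hJo : IsOpen J) (hJne : J.Nonempty) (D : ℕ) :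
    ∃ x ∈ J, ∀ P ∈ closure (orbitHull f T D J), MapClusterPt P atTop fun n => f^[n] x := by
  have : BaireSpace J := hJo.baireSpace
  have : Nonempty J := hJne.to_subtype
  let ℬ : Set (Set X) := {O ∈ countableBasis X | (O ∩ orbitHull f T D J).Nonempty}
  have : Countable ℬ := ((countable_countableBasis X).mono (Set.sep_subset _ _)).to_subtype
  let visits (k : ℬ × ℕ) : Set J := ⋃ n ≥ k.2, {x | f^[n] x ∈ (k.1 : Set X)}
  have hopen (k : ℬ × ℕ) : IsOpen (visits k) := isOpen_biUnion fun n _ =>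
    (isOpen_of_mem_countableBasis k.1.2.1).preimage ((hf.iterate n).comp continuous_subtype_val)
  have hdense (k : ℬ × ℕ) : Dense (visits k) := by
    obtain ⟨⟨O, hO, P, hPO, hP⟩, N⟩ := k
    rw [dense_iff_inter_open]
    rintro _ ⟨W, hW, rfl⟩ ⟨⟨a, haJ⟩, haW⟩
    obtain ⟨n, hn, w, hw, rfl⟩ := frequently_atTop.1 (h.frequently_mem_image hP
      Set.inter_subset_right (hW.inter hJo) ⟨a, haW, haJ⟩) N
    exact ⟨⟨w, hw.2⟩, hw.1, Set.mem_biUnion hn hPO⟩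
  obtain ⟨x, hx⟩ := (dense_iInter_of_isOpen hopen hdense).nonempty
  refine ⟨x, x.2, fun P hP => ?_⟩
  rw [(isBasis_countableBasis X).nhds_hasBasis.mapClusterPt_iff_frequently]
  rintro O ⟨hO, hPO⟩
  have hOne := mem_closure_iff.1 hP O (isOpen_of_mem_countableBasis hO) hPO
  refine frequently_atTop.2 fun N => ?_
  simpa [visits] using Set.mem_iInter.1 hx (⟨O, hO, hOne⟩, N)

theorem orbitHull_subset (h : IsRecurrentAt f T J) (hD : 0 < D) (hW : W ⊆ J) (hWo : IsOpen W)
    (hWne : W.Nonempty) {m : ℕ} (hWJ' : f^[m] '' W ⊆ f^[m] '' J') :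
    orbitHull f T D J ⊆ orbitHull f T D J' := by
  obtain ⟨n, hn, hsub⟩ := h.exists_forall_mul hW hWo hWne
  have hm : m ≤ n * ((m + 1) * D) := by nlinarith [Nat.mul_pos hn hD]
  have hshift := image_iterate_add_subset hWJ' (T + n * ((m + 1) * D) - m)
  rw [Nat.add_sub_cancel' (hm.trans (Nat.le_add_left _ T))] at hshift
  refine Set.iUnion_subset fun k => ?_
  calc f^[T + k * D] '' J
      ⊆ f^[T + n * ((m + 1) * D) + k * D] '' J' :=
        image_iterate_add_subset ((hsub _ (by positivity)).trans hshift) (k * D)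
    _ = f^[T + (n * (m + 1) + k) * D] '' J' := by ring_nf
    _ ⊆ orbitHull f T D J' := image_iterate_subset_orbitHull f T D _ J'

end IsRecurrentAt

end Recurrence

section ExpandsToBalls

variable {X : Type*} [PseudoMetricSpace X] {f : X → X} {r : ℝ} {V J J' : Set X} {T D : ℕ}

/-- Every non-empty open set has, at arbitrarily large times, images that contain a ball of
radius `r`. It is the form in which the separation of Li-Yorke pairs is used. -/
def ExpandsToBalls (f : X → X) (r : ℝ) : Prop :=
  ∀ W : Set X, IsOpen W → W.Nonempty → ∃ᶠ n in atTop, ∃ z, Metric.ball z r ⊆ f^[n] '' W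

namespace ExpandsToBalls

theorem exists_forall_frequently_ball_subset [CompactSpace X] (h : ExpandsToBalls f r)
    (hr : 0 < r) (hV : IsOpen V) (hVne : V.Nonempty) :
    ∃ p, ∃ W ⊆ V, IsOpen W ∧ W.Nonempty ∧ ∀ W' ⊆ W, IsOpen W' → W'.Nonempty →
      ∃ᶠ n in atTop, Metric.ball p (r / 2) ⊆ f^[n] '' W' := by
  obtain ⟨A, -, hA, hcover⟩ := finite_cover_balls_of_compact (isCompact_univ (X := X)) (half_pos hr)
  have : Finite A := hA
  let covered (W : Set X) : Set A :=
    {p | ∃ᶠ n in atTop, Metric.ball (p : X) (r / 2) ⊆ f^[n] '' W}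
  have hcovered {W : Set X} (hW : IsOpen W) (hWne : W.Nonempty) : (covered W).Nonempty := by
    refine frequently_exists.1 ((h W hW hWne).mono fun n ⟨z, hz⟩ => ?_)
    obtain ⟨p, hp, hzp⟩ := Set.mem_iUnion₂.1 (hcover (Set.mem_univ z))
    refine ⟨⟨p, hp⟩, (Metric.ball_subset_ball' ?_).trans hz⟩
    linarith [Metric.mem_ball'.1 hzp]
  -- By minimality, every non-empty open subset of `W` covers the same balls as `W`.
  obtain ⟨W, ⟨hWV, hW, hWne⟩, hmin⟩ := exists_minimalFor_of_wellFoundedLT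
    (fun W : Set X => W ⊆ V ∧ IsOpen W ∧ W.Nonempty) covered ⟨V, subset_rfl, hV, hVne⟩
  obtain ⟨p, hp⟩ := hcovered hW hWne
  refine ⟨p, W, hWV, hW, hWne, fun W' hW' hW'o hW'ne => ?_⟩
  have hmono : covered W' ⊆ covered W := fun q hq => hq.mono fun n hn =>
    hn.trans (Set.image_mono hW')
  exact hmin ⟨hW'.trans hWV, hW'o, hW'ne⟩ hmono hp

theorem exists_isRecurrentAt [CompactSpace X] (h : ExpandsToBalls f r) (hr : 0 < r)
    (hf : Continuous f) (hV : IsOpen V) (hVne : V.Nonempty) :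
    ∃ J ⊆ V, IsOpen J ∧ J.Nonempty ∧ ∃ T, IsRecurrentAt f T J := by
  obtain ⟨p, W, hWV, hW, hWne, hball⟩ := h.exists_forall_frequently_ball_subset hr hV hVne
  obtain ⟨T, hT⟩ := (hball W subset_rfl hW hWne).exists
  obtain ⟨w, hw, hwp⟩ := hT (Metric.mem_ball_self (half_pos hr))
  refine ⟨W ∩ f^[T] ⁻¹' Metric.ball p (r / 2), Set.inter_subset_left.trans hWV,
    hW.inter (Metric.isOpen_ball.preimage (hf.iterate T)),
    ⟨w, hw, by simpa [hwp] using hr⟩, T, fun W' hW' hW'o hW'ne => ?_⟩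
  obtain ⟨n, hn, hsub⟩ := frequently_atTop.1
    (hball W' (hW'.trans Set.inter_subset_left) hW'o hW'ne) (T + 1)
  refine ⟨n - T, by omega, ?_⟩
  rw [show T + (n - T) = n by omega]
  exact (Set.image_subset_iff.2 Set.inter_subset_right).trans hsub

theorem orbitHull_subset (h : ExpandsToBalls f r) (hr : 0 < r) (hf : Continuous f)
    (hJ : IsOpen J) (hJ' : IsOpen J') (hrec : IsRecurrentAt f T J) (hD : 0 < D) {O : Set X}
    (hO : IsOpen O) {m : ℕ} (hOJ : O ⊆ f^[m] '' J) (hOJ' : (O ∩ f^[m] '' J').Nonempty) :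
    orbitHull f T D J ⊆ orbitHull f T D J' := by
  obtain ⟨_, hO', w, hw, rfl⟩ := hOJ'
  obtain ⟨n, hn, z, hz⟩ := frequently_atTop.1
    (h (J' ∩ f^[m] ⁻¹' O) (hJ'.inter (hO.preimage (hf.iterate m))) ⟨w, hw, hO'⟩) m
  have hzJ : Metric.ball z r ⊆ f^[n] '' J := by
    have hm : f^[m] '' (J' ∩ f^[m] ⁻¹' O) ⊆ f^[m] '' J :=
      (Set.image_subset_iff.2 Set.inter_subset_right).trans hOJ
    have hshift := image_iterate_add_subset hm (n - m)
    rw [Nat.add_sub_cancel' hn] at hshift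
    exact hz.trans hshift
  obtain ⟨y, hy, hyz⟩ := hzJ (Metric.mem_ball_self hr)
  refine hrec.orbitHull_subset hD (W := J ∩ f^[n] ⁻¹' Metric.ball z r) Set.inter_subset_left
    (hJ.inter (Metric.isOpen_ball.preimage (hf.iterate n))) ⟨y, hy, by simpa [hyz] using hr⟩
    (m := n) ?_
  calc f^[n] '' (J ∩ f^[n] ⁻¹' Metric.ball z r)
      ⊆ Metric.ball z r := Set.image_subset_iff.2 Set.inter_subset_right
    _ ⊆ f^[n] '' (J' ∩ f^[m] ⁻¹' O) := hz
    _ ⊆ f^[n] '' J' := Set.image_mono Set.inter_subset_left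

theorem orbitHull_subset_of_Ioo_inter [LinearOrder X] [OrderClosedTopology X]
    (h : ExpandsToBalls f r) (hr : 0 < r) (hf : Continuous f) (hJ : IsOpen J)
    (hJc : IsPreconnected J) (hJ' : IsOpen J') (hrec : IsRecurrentAt f T J) (hD : 0 < D)
    (hJD : f^[T] '' J ⊆ f^[T + D] '' J) (hJD' : f^[T] '' J' ⊆ f^[T + D] '' J') {a b : X}
    (ha : a ∈ orbitHull f T D J) (hb : b ∈ orbitHull f T D J)
    (hab : (Set.Ioo a b ∩ orbitHull f T D J').Nonempty) :
    orbitHull f T D J ⊆ orbitHull f T D J' := by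
  obtain ⟨c, hc, hcJ'⟩ := hab
  obtain ⟨k, hk⟩ := Set.mem_iUnion.1 ha
  obtain ⟨l, hl⟩ := Set.mem_iUnion.1 hb
  obtain ⟨m, hm⟩ := Set.mem_iUnion.1 hcJ'
  have hmono := monotone_image_iterate hJD
  have haN := hmono (show k ≤ k + l + m by omega) hk
  have hbN := hmono (show l ≤ k + l + m by omega) hl
  have hcN := monotone_image_iterate hJD' (show m ≤ k + l + m by omega) hm
  have hord := (hJc.image _ (hf.iterate (T + (k + l + m) * D)).continuousOn).ordConnected
  exact h.orbitHull_subset hr hf hJ hJ' hrec hD isOpen_Ioo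
    (Set.Ioo_subset_Icc_self.trans (hord.out haN hbN)) ⟨c, hc, hcN⟩

end ExpandsToBalls

end ExpandsToBalls

section Order

instance {X : Type*} [ConditionallyCompleteLinearOrder X] [TopologicalSpace X] [OrderTopology X]
    [DenselyOrdered X] : LocallyConnectedSpace X :=
  locallyConnectedSpace_iff_connected_subsets.2 fun _ _ hU =>
    let ⟨a, b, _, hab, hsub⟩ := exists_Icc_mem_subset_of_mem_nhds hU
    ⟨Set.Icc a b, hab, isPreconnected_Icc, hsub⟩

theorem exists_isOpen_isPreconnected_subset {X : Type*} [TopologicalSpace X]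
    [LocallyConnectedSpace X] {V : Set X} (hV : IsOpen V) (hVne : V.Nonempty) :
    ∃ J ⊆ V, IsOpen J ∧ J.Nonempty ∧ IsPreconnected J := by
  obtain ⟨x, hx⟩ := hVne
  exact ⟨connectedComponentIn V x, connectedComponentIn_subset V x, hV.connectedComponentIn,
    ⟨x, mem_connectedComponentIn hx⟩, isPreconnected_connectedComponentIn⟩

theorem nonempty_iInter_of_ordConnected {X ι : Type*} [LinearOrder X] [TopologicalSpace X]
    [ClosedIicTopology X] [Finite ι] [Nonempty ι] {S : ι → Set X} (hS : ∀ i, IsCompact (S i))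
    (hord : ∀ i, (S i).OrdConnected) (hmeet : ∀ i j, (S i ∩ S j).Nonempty) :
    (⋂ i, S i).Nonempty := by
  choose a ha using fun i => (hS i).exists_isLeast (hmeet i i).left
  obtain ⟨i, hi⟩ := Finite.exists_max a
  refine ⟨a i, Set.mem_iInter.2 fun j => ?_⟩
  obtain ⟨c, hci, hcj⟩ := hmeet i j
  exact (hord j).out (ha j).1 hcj ⟨hi j, (ha i).2 hci⟩

end Order

section MonotoneDist

/-- The distance between the endpoints of an order interval increases with the interval, as it
does in subsets of the real line. -/
class MonotoneDist (X : Type*) [Dist X] [Preorder X] : Prop where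
  dist_le_dist_left {a b c : X} : a ≤ b → b ≤ c → dist a b ≤ dist a c
  dist_le_dist_right {a b c : X} : a ≤ b → b ≤ c → dist b c ≤ dist a c

instance (s : Set ℝ) : MonotoneDist s where
  dist_le_dist_left {a b c} hab hbc := by
    rw [← Subtype.coe_le_coe] at hab hbc
    simp only [Subtype.dist_eq, Real.dist_eq]
    rw [abs_of_nonpos (by linarith), abs_of_nonpos (by linarith)]
    linarith
  dist_le_dist_right {a b c} hab hbc := by
    rw [← Subtype.coe_le_coe] at hab hbc
    simp only [Subtype.dist_eq, Real.dist_eq]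
    rw [abs_of_nonpos (by linarith), abs_of_nonpos (by linarith)]
    linarith

open MonotoneDist

variable {X : Type*} [PseudoMetricSpace X] [LinearOrder X] [OrderClosedTopology X]
  [MonotoneDist X] {ε : ℝ}

theorem exists_ball_subset_of_lt_dist {S : Set X} (hS : IsPreconnected S) {x y : X} (hx : x ∈ S)
    (hy : y ∈ S) (hxy : ε < dist x y) : ∃ z, Metric.ball z (ε / 2) ⊆ S := by
  wlog hle : x ≤ y generalizing x y
  · exact this hy hx (by rwa [dist_comm]) (le_of_not_ge hle)
  -- Clamping `z` to `[x, y]` makes the midpoint found below lie between `x` and `y`.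
  let clamp (z : X) : X := max x (min z y)
  have hcont : Continuous fun z => dist x (clamp z) := by fun_prop
  have hmid : dist x y / 2 ∈ Set.Icc (dist x (clamp x)) (dist x (clamp y)) := by
    simp only [clamp, min_self, max_eq_right hle, min_eq_left hle, max_self, dist_self,
      Set.mem_Icc]
    constructor <;> linarith [dist_nonneg (x := x) (y := y)]
  obtain ⟨z, -, hz⟩ := hS.intermediate_value hx hy hcont.continuousOn hmid
  have hxz : x ≤ clamp z := le_max_left _ _
  have hzy : clamp z ≤ y := max_le hle (min_le_right _ _)
  refine ⟨clamp z, fun w hw => hS.ordConnected.out hx hy ⟨?_, ?_⟩⟩ <;> by_contra! hlt <;>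
    rw [Metric.mem_ball] at hw
  · linarith [dist_le_dist_right hlt.le hxz]
  · linarith [dist_le_dist_left hzy hlt.le, dist_triangle x (clamp z) y, dist_comm w (clamp z)]

theorem exists_forall_exists_lt_dist {ι : Type*} {S : ι → Set X} {i₀ : ι} {z u v : X}
    (hz : ∀ i, z ∈ closure (S i)) (hu : u ∈ S i₀) (hv : v ∈ S i₀) (huv : ε < dist u v)
    (hS : ∀ a ∈ S i₀, ∀ b ∈ S i₀, ∀ j, (Set.Ioo a b ∩ S j).Nonempty → S i₀ ⊆ S j) (hε : 0 < ε) :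
    ∃ q ∈ S i₀, ∀ j, ∃ p ∈ S j, ε < dist q p := by
  wlog hle : u ≤ v generalizing u v
  · exact this hv hu (by rwa [dist_comm]) (le_of_not_ge hle)
  have hlt : u < v := hle.lt_of_ne fun h => by simp [h, hε.not_gt] at huv
  rcases lt_or_ge z v with hzv | hvz
  · refine ⟨v, hv, fun j => ?_⟩
    obtain ⟨p, hpv, hp⟩ := mem_closure_iff.1 (hz j) _ isOpen_Iio hzv
    simp only [dist_comm v]
    rcases le_or_gt p u with hpu | hup
    · exact ⟨p, hp, huv.trans_le (dist_le_dist_right hpu hle)⟩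
    · exact ⟨u, hS u hu v hv j ⟨p, ⟨hup, hpv⟩, hp⟩ hu, huv⟩
  · refine ⟨u, hu, fun j => ?_⟩
    obtain ⟨p, hup, hp⟩ := mem_closure_iff.1 (hz j) _ isOpen_Ioi (hlt.trans_le hvz)
    rcases le_or_gt v p with hvp | hpv
    · exact ⟨p, hp, huv.trans_le (dist_le_dist_left hle hvp)⟩
    · exact ⟨v, hS u hu v hv j ⟨p, ⟨hup, hpv⟩, hp⟩ hv, huv⟩

end MonotoneDist

section Proximality

variable {X : Type*} [MetricSpace X] [CompactSpace X] {f : C(X, X)} {ε : ℝ} {J J' : Set X}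

theorem exists_forall_iterate_dist_lt (f : C(X, X)) (D : ℕ) {δ : ℝ} (hδ : 0 < δ) :
    ∃ η > 0, ∀ x y, dist x y < η → ∀ s < D, dist (f^[s] x) (f^[s] y) < δ := by
  have h : ∀ᶠ p : X × X in uniformity X, ∀ s ∈ Finset.range D,
      dist (f^[s] p.1) (f^[s] p.2) < δ := (eventually_all_finset _).2 fun s _ =>
    CompactSpace.uniformContinuous_of_continuous (f.continuous.iterate s)
      (Metric.dist_mem_uniformity hδ)
  obtain ⟨η, hη, hclose⟩ := Metric.mem_uniformity_dist.1 h
  exact ⟨η, hη, fun x y hxy s hs => hclose hxy s (Finset.mem_range.2 hs)⟩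

theorem exists_dist_orbitHull_lt {x y : X} (hx : x ∈ J) (hy : y ∈ J')
    (hprox : ∀ η > 0, ∃ᶠ n in atTop, dist (f^[n] x) (f^[n] y) < η) (T : ℕ) {D : ℕ} (hD : 0 < D)
    {δ : ℝ} (hδ : 0 < δ) :
    ∃ a ∈ orbitHull f T D J, ∃ b ∈ orbitHull f T D J', dist a b < δ := by
  obtain ⟨η, hη, hclose⟩ := exists_forall_iterate_dist_lt f (D + 1) hδ
  obtain ⟨n, hn, hxy⟩ := frequently_atTop.1 (hprox η hη) T
  -- `T + k * D` is the first time of the progression after `n`.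
  obtain ⟨k, s, hs, hks⟩ : ∃ k, ∃ s < D + 1, s + n = T + k * D := by
    have hdiv := Nat.div_add_mod' (n - T) D
    exact ⟨(n - T) / D + 1, D - (n - T) % D, by omega, by
      have := Nat.mod_lt (n - T) hD
      rw [add_one_mul]
      omega⟩
  have hdist := hclose _ _ hxy s hs
  rw [← Function.iterate_add_apply, ← Function.iterate_add_apply, hks] at hdist
  exact ⟨_, image_iterate_subset_orbitHull f T D k J ⟨x, hx, rfl⟩, _,
    image_iterate_subset_orbitHull f T D k J' ⟨y, hy, rfl⟩, hdist⟩

theorem DenselyChaotic.closure_orbitHull_inter_nonempty (hf : DenselyChaotic f ε)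
    (hJ : IsOpen J) (hJne : J.Nonempty) (hJ' : IsOpen J') (hJ'ne : J'.Nonempty) (T : ℕ) {D : ℕ}
    (hD : 0 < D) :
    (closure (orbitHull f T D J) ∩ closure (orbitHull f T D J')).Nonempty := by
  obtain ⟨x, hx, y, hy, hprox, -⟩ := hf.exists_frequently_dist hJ hJne hJ' hJ'ne
  rw [← Set.not_disjoint_iff_nonempty_inter]
  intro hdisj
  obtain ⟨δ, hδ, hthick⟩ := hdisj.exists_thickenings isClosed_closure.isCompact isClosed_closure
  obtain ⟨a, ha, b, hb, hab⟩ := exists_dist_orbitHull_lt hx hy hprox T hD hδ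
  exact Set.disjoint_left.1 hthick
    (Metric.mem_thickening_iff.2 ⟨a, subset_closure ha, by rwa [dist_comm]⟩)
    (Metric.self_subset_thickening hδ _ (subset_closure hb))

end Proximality

section Tuples

variable {X ι : Type*} [MetricSpace X] [CompactSpace X] [LinearOrder X] [OrderClosedTopology X]
  [Finite ι] {f : C(X, X)} {ε : ℝ} {J : ι → Set X} {T D : ℕ}

theorem DenselyChaotic.exists_forall_mem_closure_orbitHull [Nonempty ι]
    (hf : DenselyChaotic f ε) (hJ : ∀ i, IsOpen (J i)) (hJne : ∀ i, (J i).Nonempty)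
    (hJc : ∀ i, IsPreconnected (J i)) (hD : 0 < D)
    (hJD : ∀ i, f^[T] '' J i ⊆ f^[T + D] '' J i) :
    ∃ z, ∀ i, z ∈ closure (orbitHull f T D (J i)) := by
  obtain ⟨z, hz⟩ := nonempty_iInter_of_ordConnected
    (fun i => isClosed_closure.isCompact (s := closure (orbitHull f T D (J i))))
    (fun i => (isPreconnected_orbitHull f.continuous (hJc i) (hJD i)).closure.ordConnected)
    fun i j => hf.closure_orbitHull_inter_nonempty (hJ i) (hJne i) (hJ j) (hJne j) T hD
  exact ⟨z, Set.mem_iInter.1 hz⟩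

variable [LocallyConnectedSpace X] [MonotoneDist X]

theorem DenselyChaotic.expandsToBalls (hf : DenselyChaotic f ε) : ExpandsToBalls f (ε / 2) := by
  intro V hV hVne
  obtain ⟨J, hJV, hJ, hJne, hJc⟩ := exists_isOpen_isPreconnected_subset hV hVne
  obtain ⟨x, hx, y, hy, -, hsep⟩ := hf.exists_frequently_dist hJ hJne hJ hJne
  refine hsep.mono fun n hn => ?_
  obtain ⟨z, hz⟩ := exists_ball_subset_of_lt_dist
    (hJc.image f^[n] (f.continuous.iterate n).continuousOn)
    (Set.mem_image_of_mem _ hx) (Set.mem_image_of_mem _ hy) hn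
  exact ⟨z, hz.trans (Set.image_mono hJV)⟩

theorem DenselyChaotic.exists_preconnected_isRecurrentAt (hf : DenselyChaotic f ε) (hε : 0 < ε)
    {V : Set X} (hV : IsOpen V) (hVne : V.Nonempty) :
    ∃ J ⊆ V, IsOpen J ∧ J.Nonempty ∧ IsPreconnected J ∧ ∃ T, IsRecurrentAt f T J := by
  obtain ⟨R, hRV, hR, hRne, T, hrec⟩ :=
    hf.expandsToBalls.exists_isRecurrentAt (half_pos hε) f.continuous hV hVne
  obtain ⟨J, hJR, hJ, hJne, hJc⟩ := exists_isOpen_isPreconnected_subset hR hRne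
  exact ⟨J, hJR.trans hRV, hJ, hJne, hJc, T, hrec.mono_set hJR⟩

theorem DenselyChaotic.exists_forall_isRecurrentAt (hf : DenselyChaotic f ε) (hε : 0 < ε)
    (i₀ : ι) {V : ι → Set X} (hV : ∀ i, IsOpen (V i)) (hVne : ∀ i, (V i).Nonempty) :
    ∃ J : ι → Set X, (∀ i, J i ⊆ V i) ∧ (∀ i, IsOpen (J i)) ∧ (∀ i, (J i).Nonempty) ∧
      (∀ i, IsPreconnected (J i)) ∧ ∃ T, (∀ i, IsRecurrentAt f T (J i)) ∧
      ∃ u ∈ f^[T] '' J i₀, ∃ v ∈ f^[T] '' J i₀, ε < dist u v := by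
  choose J hJV hJ hJne hJc T hrec using
    fun i => hf.exists_preconnected_isRecurrentAt hε (hV i) (hVne i)
  obtain ⟨N, hN⟩ := (Set.finite_range T).bddAbove
  obtain ⟨x, hx, y, hy, -, hsep⟩ := hf.exists_frequently_dist (hJ i₀) (hJne i₀) (hJ i₀) (hJne i₀)
  obtain ⟨M, hM, hxy⟩ := frequently_atTop.1 hsep N
  exact ⟨J, hJV, hJ, hJne, hJc, M, fun i => (hrec i).mono_time ((hN ⟨i, rfl⟩).trans hM),
    _, ⟨x, hx, rfl⟩, _, ⟨y, hy, rfl⟩, hxy⟩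

theorem DenselyChaotic.exists_mapClusterPt_tuple (hf : DenselyChaotic f ε) (hε : 0 < ε) (i₀ : ι)
    {𝒱 : Set (ι → X)} (h𝒱 : IsOpen 𝒱) (h𝒱ne : 𝒱.Nonempty) :
    ∃ x ∈ 𝒱, (∃ z, MapClusterPt (fun _ => z) atTop fun (n : ℕ) i => f^[n] (x i)) ∧
      ∃ P : ι → X, (∀ j ≠ i₀, ε < dist (P i₀) (P j)) ∧
        MapClusterPt P atTop fun (n : ℕ) i => f^[n] (x i) := by
  classical
  have : Nonempty ι := ⟨i₀⟩
  cases nonempty_fintype ι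
  obtain ⟨y, hy⟩ := h𝒱ne
  obtain ⟨V, hV, hV𝒱⟩ := isOpen_pi_iff'.1 h𝒱 y hy
  obtain ⟨J, hJV, hJ, hJne, hJc, T, hrec, u, hu, v, hv, huv⟩ :=
    hf.exists_forall_isRecurrentAt hε i₀ (fun i => (hV i).1) fun i => ⟨y i, (hV i).2⟩
  obtain ⟨D, hD, hJD⟩ := IsRecurrentAt.exists_common_period hrec (fun i => subset_rfl) hJ hJne
  obtain ⟨z, hz⟩ := hf.exists_forall_mem_closure_orbitHull hJ hJne hJc hD hJD
  obtain ⟨q, hq, hsep⟩ := exists_forall_exists_lt_dist hz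
    (image_subset_orbitHull f T D _ hu) (image_subset_orbitHull f T D _ hv) huv
    (fun a ha b hb j => hf.expandsToBalls.orbitHull_subset_of_Ioo_inter (half_pos hε) f.continuous
      (hJ i₀) (hJc i₀) (hJ j) (hrec i₀) hD (hJD i₀) (hJD j) ha hb) hε
  choose p hp hqp using hsep
  obtain ⟨x, hx, hcluster⟩ := (IsRecurrentAt.pi hrec hJ).exists_forall_mapClusterPt
    (continuous_pi fun i => f.continuous.comp (continuous_apply i))
    (isOpen_set_pi Set.finite_univ fun i _ => hJ i) (Set.univ_pi_nonempty_iff.2 hJne) D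
  simp only [Pi.map_iterate] at hcluster
  refine ⟨x, hV𝒱 fun i hi => hJV i (hx i hi), ⟨z, hcluster _ ?_⟩, Function.update p i₀ q,
    fun j hj => by simpa [hj] using hqp j, hcluster _ (subset_closure ?_)⟩
  · refine closure_mono (pi_orbitHull_subset hJD) ?_
    rw [closure_pi_set]
    exact fun i _ => hz i
  · refine pi_orbitHull_subset hJD fun i _ => ?_
    rcases eq_or_ne i i₀ with rfl | hi
    · simpa using hq
    · simpa [hi] using hp i

end Tuples

section Hyperspace

variable {X ι κ : Type*} [MetricSpace X] [Finite ι] [Nonempty ι] [Finite κ] [Nonempty κ]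

/-- The set of the entries of a finite tuple of points, as a point of the hyperspace. -/
def rangeCompacts (x : ι → X) : NonemptyCompacts X :=
  ⟨⟨Set.range x, (Set.finite_range x).isCompact⟩, Set.range_nonempty x⟩

theorem continuous_rangeCompacts : Continuous (rangeCompacts : (ι → X) → NonemptyCompacts X) :=
  letI : TopologicalSpace (Set X) := .vietoris X
  NonemptyCompacts.isEmbedding_coe.continuous_iff.2 vietoris.continuous_range_of_finite

theorem induced_iterate_rangeCompacts [CompactSpace X] (f : C(X, X)) (n : ℕ) (x : ι → X) :
    (induced f)^[n] (rangeCompacts x) = rangeCompacts fun i => f^[n] (x i) := by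
  induction n with
  | zero => rfl
  | succ n ih =>
    rw [Function.iterate_succ_apply', ih]
    refine NonemptyCompacts.ext ((Set.range_comp f fun i => f^[n] (x i)).symm.trans ?_)
    simp only [Function.iterate_succ_apply']
    rfl

theorem lt_dist_of_forall_lt_dist {K L : NonemptyCompacts X} {ε : ℝ} {a : X} (ha : a ∈ K)
    (h : ∀ b ∈ L, ε < dist a b) : ε < dist K L := by
  obtain ⟨b, hb, hab⟩ := L.isCompact.exists_infDist_eq_dist L.nonempty a
  calc ε < dist a b := h b hb
    _ = Metric.infDist a L := hab.symm
    _ ≤ dist K L := Metric.infDist_le_hausdorffDist_of_mem ha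
        (Metric.hausdorffEDist_ne_top_of_nonempty_of_bounded K.nonempty L.nonempty
          K.isCompact.isBounded L.isCompact.isBounded)

variable [CompactSpace X] {f : C(X, X)} {ε : ℝ} {x P : ι ⊕ κ → X} {z : X}

theorem mapClusterPt_dist_induced (h : MapClusterPt P atTop fun (n : ℕ) i => f^[n] (x i)) :
    MapClusterPt (dist (rangeCompacts (P ∘ Sum.inl)) (rangeCompacts (P ∘ Sum.inr))) atTop
      fun n : ℕ => dist ((induced f)^[n] (rangeCompacts (x ∘ Sum.inl)))
        ((induced f)^[n] (rangeCompacts (x ∘ Sum.inr))) := by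
  simp only [induced_iterate_rangeCompacts]
  have hcont : Continuous fun y : ι ⊕ κ → X =>
      dist (rangeCompacts (y ∘ Sum.inl)) (rangeCompacts (y ∘ Sum.inr)) :=
    (continuous_rangeCompacts.comp (by fun_prop)).dist (continuous_rangeCompacts.comp (by fun_prop))
  exact h.continuousAt_comp hcont.continuousAt

theorem rangeCompacts_mem_liYorkePairs {i₀ : ι}
    (hprox : MapClusterPt (fun _ => z) atTop fun (n : ℕ) i => f^[n] (x i))
    (hP : ∀ j ≠ Sum.inl i₀, ε < dist (P (Sum.inl i₀)) (P j))
    (hsep : MapClusterPt P atTop fun (n : ℕ) i => f^[n] (x i)) :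
    (rangeCompacts (x ∘ Sum.inl), rangeCompacts (x ∘ Sum.inr)) ∈
      liYorkePairs (induced f) ε := by
  refine ⟨mem_C₁_iff.2 ?_, mem_C₂_iff.2 ⟨_, ?_, mapClusterPt_dist_induced hsep⟩⟩
  · have hconst : rangeCompacts (fun _ : ι => z) = rangeCompacts fun _ : κ => z :=
      NonemptyCompacts.ext (Set.range_const.trans Set.range_const.symm)
    simpa only [Function.comp_def, hconst, dist_self] using mapClusterPt_dist_induced hprox
  · refine lt_dist_of_forall_lt_dist (a := P (Sum.inl i₀)) ⟨i₀, rfl⟩ ?_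
    rintro _ ⟨j, rfl⟩
    exact hP (Sum.inr j) Sum.inr_ne_inl

end Hyperspace

end DenseChaos

open DenseChaos in
theorem theorem4p4_general {X : Type*} [MetricSpace X] [CompactSpace X] [LinearOrder X]
    [OrderClosedTopology X] [LocallyConnectedSpace X] [MonotoneDist X] (ε : ℝ)
    (hε : 0 < ε) (f : C(X, X)) (hf : DenselyChaotic f ε) :
    DenselyChaotic (induced f) ε := by
  have hdense := NonemptyCompacts.dense_setOfPred_finite (α := X)
  refine dense_iff_inter_open.2 fun U hU hUne => ?_
  obtain ⟨⟨K, L⟩, hKL, hK : (K : Set X).Finite, hL : (L : Set X).Finite⟩ :=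
    (hdense.prod hdense).inter_open_nonempty U hU hUne
  have : Finite K := hK
  have : Finite L := hL
  have : Nonempty K := K.nonempty.to_subtype
  have : Nonempty L := L.nonempty.to_subtype
  let pair (x : K ⊕ L → X) := (rangeCompacts (x ∘ Sum.inl), rangeCompacts (x ∘ Sum.inr))
  have hpair : Continuous pair := (continuous_rangeCompacts.comp (by fun_prop)).prodMk
    (continuous_rangeCompacts.comp (by fun_prop))
  have hpairKL : pair (Sum.elim (↑) (↑)) = (K, L) :=
    Prod.ext (NonemptyCompacts.ext Subtype.range_coe) (NonemptyCompacts.ext Subtype.range_coe)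
  obtain ⟨k⟩ := ‹Nonempty K›
  obtain ⟨x, hx, ⟨z, hz⟩, P, hP, hsep⟩ := hf.exists_mapClusterPt_tuple hε (Sum.inl k)
    (hU.preimage hpair) ⟨_, Set.mem_preimage.2 (hpairKL ▸ hKL)⟩
  exact ⟨pair x, hx, rangeCompacts_mem_liYorkePairs hz hP hsep⟩

theorem theorem4p4 (ε : ℝ) (hε : 0 < ε) (f : C(unitInterval, unitInterval))
    (hf : DenseChaos.DenselyChaotic f ε) :
    DenseChaos.DenselyChaotic (DenseChaos.induced f) ε :=
  theorem4p4_general ε hε f hf
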